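/- An affine $\mathbb{Z}$-VASS $\mathcal{V}=(d,Q,T)$ consists of a dimension $d$ (the number of counters), a finite set $Q$ of control-states and a finite set $T\subseteq Q\times\mathbb{Z}^{d\times d}\times\mathbb{Z}^d\times Q$ of transitions. A transition $(p,A,b,q)$ leads from the configuration $p(u)$ to the configuration $q(Au+b)$, for every $u\in\mathbb{Z}^d$; write $p(u)\to^* q(v)$ if there is a (possibly empty) sequence of such steps from $p(u)$ to $q(v)$. A transfer (respectively copy) matrix is a $d\times d$ matrix with entries in $\{0,1\}$ that has exactly one $1$ in each column (respectively in each row). $\mathcal{V}$ is a transfer + copy $\mathbb{Z}$-VASS if the monoid generated by the matrices of its transitions is contained in the smallest monoid that contains all $d\times d$ transfer matrices and all $d\times d$ copy matrices. The reachability problem for transfer + copy $\mathbb{Z}$-VASS is: given a transfer + copy $\mathbb{Z}$-VASS $\mathcal{V}$ and two configurations $p(u)$, $q(v)$ of it, decide whether $p(u)\to^* q(v)$. Proposition. The reachability problem for transfer + copy $\mathbb{Z}$-VASS is undecidable, even when restricted to $d=3$ counters, and even when, in addition, the matrix of every transition is itself a transfer matrix or a copy matrix. (That is, no algorithm answers correctly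 on all inputs that satisfy the stated restriction, whatever it does on other inputs.) -/

import Mathlib

/-- A transition `(p, A, b, q)` of dimension `d` over the control-states `Q`: it goes from `p` to `q`
and acts on the counters by `x ↦ A x + b`. -/
abbrev VASSTransition (d : ℕ) (Q : Type) : Type :=
  Q × Matrix (Fin d) (Fin d) ℤ × (Fin d → ℤ) × Q

/-- An affine integer vector addition system with states of dimension `d` over the set `Q`
of control-states: a finite set of transitions. (`Q` is finite wherever this is used.) -/
structure AffineZVASS (d : ℕ) (Q : Type) where
  transitions : Finset (VASSTransition d Q)

namespace AffineZVASS

variable {d : ℕ} {Q : Type}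

/-- `V.Step (p, u) (q, v)`: some transition of `V` leads from `p(u)` to `q(v)`. -/
def Step (V : AffineZVASS d Q) (c c' : Q × (Fin d → ℤ)) : Prop :=
  ∃ A : Matrix (Fin d) (Fin d) ℤ, ∃ b : Fin d → ℤ,
    (c.1, A, b, c'.1) ∈ V.transitions ∧ c'.2 = A.mulVec c.2 + b

/-- The reachability relation: there is a (possibly empty) run between two configurations. -/
def Reaches (V : AffineZVASS d Q) : Q × (Fin d → ℤ) → Q × (Fin d → ℤ) → Prop :=
  Relation.ReflTransGen V.Step

/-- The set of matrices that occur on the transitions. -/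
def matrices (V : AffineZVASS d Q) : Set (Matrix (Fin d) (Fin d) ℤ) :=
  {A | ∃ t ∈ V.transitions, t.2.1 = A}

/-- The monoid of `V`, generated by its matrices. -/
def monoid (V : AffineZVASS d Q) : Submonoid (Matrix (Fin d) (Fin d) ℤ) :=
  Submonoid.closure V.matrices

end AffineZVASS

/-- A transfer matrix: a 0-1 matrix with exactly one `1` in each column. -/
def IsTransferMatrix {d : ℕ} (A : Matrix (Fin d) (Fin d) ℤ) : Prop :=
  (∀ i j, A i j = 0 ∨ A i j = 1) ∧ ∀ j, ∃! i, A i j = 1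

/-- A copy matrix: a 0-1 matrix with exactly one `1` in each row. -/
def IsCopyMatrix {d : ℕ} (A : Matrix (Fin d) (Fin d) ℤ) : Prop :=
  (∀ i j, A i j = 0 ∨ A i j = 1) ∧ ∀ i, ∃! j, A i j = 1

theorem isCopyMatrix_iff_exists {d : ℕ} (A : Matrix (Fin d) (Fin d) ℤ) :
    IsCopyMatrix A ↔ ∃ f : Fin d → Fin d, ∀ i j, A i j = if f i = j then 1 else 0 := by
  constructor
  · rintro ⟨h01, h⟩
    choose f hf hu using h
    refine ⟨f, fun i j => ?_⟩
    split_ifs with hij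
    · rw [← hij]
      exact hf i
    · rcases h01 i j with h0 | h1
      · exact h0
      · exact absurd (hu i j h1).symm hij
  · rintro ⟨f, hf⟩
    refine ⟨fun i j => ?_, fun i => ⟨f i, ?_, fun j hj => ?_⟩⟩
    · rw [hf]
      split_ifs <;> simp
    · simp [hf]
    · by_contra hne
      have h2 : ¬ f i = j := fun h => hne h.symm
      simp [hf, h2] at hj

theorem isTransferMatrix_iff_transpose {d : ℕ} (A : Matrix (Fin d) (Fin d) ℤ) :
    IsTransferMatrix A ↔ IsCopyMatrix A.transpose :=
  ⟨fun h => ⟨fun i j => h.1 j i, h.2⟩, fun h => ⟨fun i j => h.1 j i, h.2⟩⟩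

theorem IsCopyMatrix.one {d : ℕ} : IsCopyMatrix (1 : Matrix (Fin d) (Fin d) ℤ) :=
  (isCopyMatrix_iff_exists _).2 ⟨id, fun i j => by simp [Matrix.one_apply]⟩

theorem IsCopyMatrix.mul {d : ℕ} {A B : Matrix (Fin d) (Fin d) ℤ}
    (hA : IsCopyMatrix A) (hB : IsCopyMatrix B) : IsCopyMatrix (A * B) := by
  obtain ⟨f, hf⟩ := (isCopyMatrix_iff_exists A).1 hA
  obtain ⟨g, hg⟩ := (isCopyMatrix_iff_exists B).1 hB
  exact (isCopyMatrix_iff_exists _).2 ⟨g ∘ f, fun i j => by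
    rw [Matrix.mul_apply, Finset.sum_eq_single (f i)]
    · simp [hf, hg]
    · intro k _ hk
      have h : ¬ f i = k := fun h => hk h.symm
      simp [hf, h]
    · simp⟩

/-- A class of matrices: a monoid of matrices in every dimension. -/
abbrev MatrixClass : Type := (d : ℕ) → Submonoid (Matrix (Fin d) (Fin d) ℤ)

/-- The class of copy matrices. -/
def copyClass : MatrixClass := fun _ =>
  { carrier := {A | IsCopyMatrix A}
    one_mem' := IsCopyMatrix.one
    mul_mem' := IsCopyMatrix.mul }

/-- The class of transfer matrices. -/
def transferClass : MatrixClass := fun _ =>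
  { carrier := {A | IsTransferMatrix A}
    one_mem' := (isTransferMatrix_iff_transpose _).2 (by
      rw [Matrix.transpose_one]
      exact IsCopyMatrix.one)
    mul_mem' := fun {A B} hA hB => (isTransferMatrix_iff_transpose _).2 (by
      rw [Matrix.transpose_mul]
      exact IsCopyMatrix.mul ((isTransferMatrix_iff_transpose B).1 hB)
        ((isTransferMatrix_iff_transpose A).1 hA)) }

/-- The sum of two classes: in every dimension the smallest monoid that contains both. -/
def MatrixClass.add (C C' : MatrixClass) : MatrixClass := fun d => C d ⊔ C' d

/-- `V` belongs to the class `C`. -/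
def AffineZVASS.BelongsTo {d : ℕ} {Q : Type} (V : AffineZVASS d Q) (C : MatrixClass) : Prop :=
  V.monoid ≤ C d

/-- An input of the reachability problem: an affine integer VASS with control-states
`0, …, numStates - 1`, a source and a target configuration. -/
structure ReachInput where
  dim : ℕ
  numStates : ℕ
  vass : AffineZVASS dim (Fin numStates)
  source : Fin numStates × (Fin dim → ℤ)
  target : Fin numStates × (Fin dim → ℤ)

/-- The input is a positive instance of the reachability problem. -/
def ReachInput.IsPositive (I : ReachInput) : Prop :=
  I.vass.Reaches I.source I.target

/-- The finite objects that an algorithm for the reachability problem reads: dimension, number of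
control-states, list of transitions (matrices being written as lists of rows), and the two
configurations. -/
abbrev ReachCode : Type :=
  ℕ × ℕ × List (ℕ × List (List ℤ) × List ℤ × ℕ) × (ℕ × List ℤ) × (ℕ × List ℤ)

/-- A configuration, written out. -/
def configCode {d n : ℕ} (c : Fin n × (Fin d → ℤ)) : ℕ × List ℤ :=
  (c.1.val, List.ofFn c.2)

/-- A transition, written out. -/
def transitionCode {d n : ℕ} (t : VASSTransition d (Fin n)) :
    ℕ × List (List ℤ) × List ℤ × ℕ :=
  (t.1.val, List.ofFn (fun i => List.ofFn (t.2.1 i)), List.ofFn t.2.2.1, t.2.2.2.val)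

/-- `I.IsCode x`: `x` is a written form of the input `I`; the transitions may be listed in
any order, possibly with repetitions. -/
def ReachInput.IsCode (I : ReachInput) (x : ReachCode) : Prop :=
  ∃ ts : List (VASSTransition I.dim (Fin I.numStates)),
    (∀ t, t ∈ ts ↔ t ∈ I.vass.transitions) ∧
    x = (I.dim, I.numStates, ts.map transitionCode, configCode I.source, configCode I.target)

/-- The reachability problem restricted to the inputs that satisfy `P` is decidable: some algorithm,
given a code of an input that satisfies `P`, answers correctly. On codes of other inputs and
on malformed codes it may give any answer. -/
def ReachDecidableOn (P : ReachInput → Prop) : Prop :=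
  ∃ f : ReachCode → Bool, Computable f ∧
    ∀ (I : ReachInput) (x : ReachCode), P I → I.IsCode x → (f x = true ↔ I.IsPositive)

/-!
The halting problem is reduced to reachability in a fixed transfer + copy VASS with three
counters; only the first counter of the source depends on the instance.

A fixed Turing machine with finitely many symbols and labels halts on the binary digits of `n` if
and only if the code number `n` halts on input `0` (`exists_finite_turingMachine`). A finite queue
machine simulates it by rotating a word that describes the tape; this queue machine empties its
queue if and only if the Turing machine halts (`exists_queueMachine`).

A run of a queue machine that empties its queue is a sequence of transitions, enabled or not, for
which the word `X` of all letters ever in the queue, the initial ones included, equals the word `Y`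
of all removed letters. Conversely, a sequence of transitions with `X = Y` at the end, in which the
removed letters are merely guessed, is an honest run: whenever `Y` is a prefix of `X` with a
nonempty remainder, the next guess continues `Y` to a prefix of the final word, hence it is the
front letter of the queue (`QueueMachine.completable_of_program_reaches`). So the words need not be
inspected before the end, and the queue machine works as an instance of the Post correspondence
problem with control states.

The words are stored as numbers in base `2 ^ k`, without the digit `0`, in the first two counters.
Appending a letter means multiplying by `2 ^ k` and adding a digit. Doubling a counter takes a copy
of it into the third counter, followed by a transfer of the third counter back to it
(`run_appendOps_zero`, `run_appendOps_one`). At the end both words are compared by decreasing their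
numbers together down to the target `0` (`QueueMachine.program_reaches_iff`).

The source is a primitive recursive function of the instance (`primrec_wordValue_trNat`), hence a
decision procedure for reachability would decide the halting problem. The matrices are transfer or
copy matrices, so that the strongest of the three claims implies the other two. -/

section TuringMachines

/-! ### Turing machines with finitely many labels -/

open Turing StateTransition

/-- The domain of a partial recursive function is the halting set of a single Turing machine with
finitely many symbols and labels, whose initial tape consists of a fixed symbol and the binary
digits of the input, most significant first. It is obtained by compiling a code through the stack
machines and one-tape machines of Mathlib. -/
theorem exists_finite_turingMachine {f : ℕ →. ℕ} (hf : Partrec f) :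
    ∃ (Γ Λ : Type) (_ : Fintype Γ) (_ : Inhabited Γ) (_ : Fintype Λ) (_ : Inhabited Λ)
      (M : TM0.Machine Γ Λ) (a : Γ) (g : PartrecToTM2.Γ' → Γ), ∀ n : ℕ,
      (eval (TM0.step M) (TM0.init (a :: (PartrecToTM2.trNat n).reverse.map g))).Dom ↔
        (f n).Dom := by
  classical
  obtain ⟨c, hc⟩ := ToPartrec.Code.exists_code (Nat.Partrec'.part_iff₁.2 hf)
  let iΛ : Inhabited PartrecToTM2.Λ' := ⟨PartrecToTM2.trNormal c .halt⟩
  let iK : Fintype PartrecToTM2.K' := ⟨{.main, .rev, .aux, .stack}, by rintro (_ | _) <;> decide⟩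
  let M₂ := PartrecToTM2.tr
  let M₁ := TM2to1.tr M₂
  let M₀ := TM1to0.tr M₁
  have sup₂ : TM2.Supports M₂ (PartrecToTM2.codeSupp c .halt) := PartrecToTM2.tr_supports c .halt
  have sup₀ := TM1to0.tr_supports M₁ (TM2to1.tr_supports M₂ sup₂)
  set S := TM1to0.trStmts M₁ (TM2to1.trSupp M₂ (PartrecToTM2.codeSupp c .halt))
  -- The machine `M₀` has infinitely many labels; it is restricted to the finite supporting set `S`.
  let iS : Inhabited S := ⟨⟨default, sup₀.1⟩⟩
  let g₁ : PointedMap (TM1to0.Λ' M₁) S :=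
    ⟨fun q => if h : q ∈ S then ⟨q, h⟩ else default, by
      have h : default ∈ S := sup₀.1
      simp only [h, dif_pos]; rfl⟩
  let g₂ : S → TM1to0.Λ' M₁ := Subtype.val
  have hg : ∀ q ∈ (S : Set (TM1to0.Λ' M₁)), g₂ (g₁ q) = q := by
    intro q hq
    have h : q ∈ S := hq
    change Subtype.val (if h : q ∈ S then (⟨q, h⟩ : S) else default) = q
    rw [dif_pos h]
  let Γ : Type := TM2to1.Γ' PartrecToTM2.K' fun _ => PartrecToTM2.Γ'
  let ι : PointedMap Γ Γ := ⟨id, rfl⟩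
  let g : PartrecToTM2.Γ' → Γ :=
    fun x => (false, Function.update (fun _ => none) PartrecToTM2.K'.main (some x))
  let a : Γ := (true, Function.update (fun _ => none) PartrecToTM2.K'.main (some .cons))
  refine ⟨Γ, S, inferInstance, inferInstance, inferInstance, iS, M₀.map ι ι g₁ g₂, a, g,
    fun n => ?_⟩
  have h₀ := tr_eval_dom (TM0.Machine.map_respects M₀ ι ι g₁ g₂ sup₀ (fun _ => rfl) hg)
    (a₁ := TM0.init (TM2to1.trInit .main (PartrecToTM2.trList [n]))) ⟨sup₀.1, rfl⟩
  rw [TM0.map_init, show (ι : Γ → Γ) = id from rfl, List.map_id] at h₀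
  have h₁ := tr_eval_dom (TM1to0.tr_respects M₁)
    (a₁ := TM1.init (TM2to1.trInit .main (PartrecToTM2.trList [n]))) rfl
  have h₂ := tr_eval_dom (TM2to1.tr_respects M₂)
    (TM2to1.trCfg_init (Λ := PartrecToTM2.Λ') (σ := Option PartrecToTM2.Γ') .main
      (PartrecToTM2.trList [n]))
  have hinit : TM2.init (Λ := PartrecToTM2.Λ') (σ := Option PartrecToTM2.Γ') .main
      (PartrecToTM2.trList [n]) = PartrecToTM2.init c [n] := by
    unfold TM2.init PartrecToTM2.init
    congr 1
    funext k
    cases k <;> rfl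
  have htape : (TM2to1.trInit .main (PartrecToTM2.trList [n]) : List Γ) =
      a :: (PartrecToTM2.trNat n).reverse.map g := by
    simp only [TM2to1.trInit, PartrecToTM2.trList, List.reverse_append, List.reverse_cons,
      List.reverse_nil, List.nil_append, List.singleton_append]
    rfl
  have hdom : (f n).Dom ↔ (c.eval [n]).Dom := by
    rw [show c.eval [n] = _ from hc ⟨[n], rfl⟩]; rfl
  rw [hdom, ← htape]
  refine h₀.trans (h₁.trans (h₂.trans ?_))
  rw [hinit, PartrecToTM2.tr_eval]
  rfl

/-! ### Queue machines -/

/-- A deterministic queue machine with control states `Q` over the alphabet `A`: in state `q`, with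
the letter `a` at the front of the queue, `a` is removed, the word `(δ q a).1` is appended at the
back, and the new state is `(δ q a).2`. The function is total, so a machine stops only when its
queue is empty. -/
abbrev QueueMachine (Q A : Type) : Type := Q → A → List A × Q

namespace QueueMachine

variable {Q A : Type}

/-- One step of a queue machine; `none` when the queue is empty. -/
def step (δ : QueueMachine Q A) : Q × List A → Option (Q × List A)
  | (_, []) => none
  | (q, a :: w) => some ((δ q a).2, w ++ (δ q a).1)

/-- From the given configuration, the machine eventually empties its queue. -/
def Empties (δ : QueueMachine Q A) (c : Q × List A) : Prop :=
  ∃ q, StateTransition.Reaches δ.step c (q, [])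

theorem empties_iff_dom (δ : QueueMachine Q A) (c : Q × List A) :
    δ.Empties c ↔ (eval δ.step c).Dom := by
  rw [Part.dom_iff_mem]
  constructor
  · rintro ⟨q, h⟩
    exact ⟨_, mem_eval.2 ⟨h, rfl⟩⟩
  · rintro ⟨⟨q, w⟩, h⟩
    obtain ⟨h₁, h₂⟩ := mem_eval.1 h
    cases w with
    | nil => exact ⟨q, h₁⟩
    | cons a w => cases h₂

theorem empties_cons (δ : QueueMachine Q A) (q : Q) (a : A) (w : List A) :
    δ.Empties (q, a :: w) ↔ δ.Empties ((δ q a).2, w ++ (δ q a).1) := by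
  rw [empties_iff_dom, empties_iff_dom,
    reaches_eval (Relation.ReflTransGen.single (rfl : _ ∈ step δ (q, a :: w)))]

end QueueMachine

/-! ### Simulation of a Turing machine by rotating its tape -/

namespace TapeRotation

variable {Γ Λ : Type}

/-- The control states of the queue machine that simulates a Turing machine. The queue holds the
tape as a word, and one full rotation of the queue performs one step of the Turing machine. -/
inductive Phase (Γ Λ : Type) : Type
  /-- The head has not been met; `b` is the cell read last, not yet written back. -/
  | hold (b : Γ)
  /-- The Turing machine has moved right into state `q`; the next cell receives the head. -/
  | mark (q : Λ)
  /-- The step has been performed; the rest of the tape is copied. -/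
  | copy
  /-- The Turing machine has halted; the queue is emptied. -/
  | drain

instance [Finite Γ] [Finite Λ] : Finite (Phase Γ Λ) :=
  Finite.of_injective
    (fun p => match p with
      | .hold b => (Sum.inl b : Γ ⊕ Λ ⊕ Bool)
      | .mark q => .inr (.inl q)
      | .copy => .inr (.inr false)
      | .drain => .inr (.inr true))
    (by rintro (_ | _ | _ | _) (_ | _ | _ | _) <;> simp)

/-- The letters of the queue: tape cells, the tape cell under the head together with the label of
the Turing machine, and the right end of the tape. -/
inductive Letter (Γ Λ : Type) : Type
  | plain (a : Γ)
  | head (q : Λ) (a : Γ)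
  | sep

instance [Finite Γ] [Finite Λ] : Finite (Letter Γ Λ) :=
  Finite.of_injective
    (fun x => match x with
      | .plain a => (Sum.inl a : Γ ⊕ (Λ × Γ) ⊕ Unit)
      | .head q a => .inr (.inl (q, a))
      | .sep => .inr (.inr ()))
    (by rintro (_ | _ | _) (_ | _ | _) <;> simp)

open Letter Phase

variable [Inhabited Γ] [Inhabited Λ]

/-- The queue machine that simulates `M`. Passing the separator, it starts the next rotation with a
blank held, so that every rotation adds a blank cell at the left end and a left move never runs off
the word; a right move onto the separator adds a blank cell at the right end. Combinations that do
not arise from a tape word empty the queue. -/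
def machine (M : TM0.Machine Γ Λ) : QueueMachine (Phase Γ Λ) (Letter Γ Λ)
  | hold b, plain c => ([plain b], hold c)
  | hold b, head q a =>
    match M q a with
    | none => ([], drain)
    | some (q', .move .left) => ([head q' b, plain a], copy)
    | some (q', .move .right) => ([plain b, plain a], mark q')
    | some (q', .write a') => ([plain b, head q' a'], copy)
  | hold _, sep => ([], drain)
  | mark q, plain c => ([head q c], copy)
  | mark q, sep => ([head q default, sep], hold default)
  | mark _, head _ _ => ([], drain)
  | copy, sep => ([sep], hold default)
  | copy, x => ([x], copy)
  | drain, _ => ([], drain)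

variable (M : TM0.Machine Γ Λ)

/-- In the phase `hold`, cells move to the back of the queue with a delay of one cell. -/
theorem reaches_hold (m : List Γ) : ∀ (b : Γ) (rest : List (Letter Γ Λ)) (m' : List Γ) (b' : Γ),
    b :: m = m' ++ [b'] →
    Reaches (machine M).step (hold b, m.map plain ++ rest) (hold b', rest ++ m'.map plain) := by
  induction m with
  | nil =>
    intro b rest m' b' h
    obtain ⟨rfl, rfl⟩ : m' = [] ∧ b = b' := by
      rcases m' with _ | ⟨x, m'⟩ <;> simp_all
    simpa using! Relation.ReflTransGen.refl
  | cons c m ih =>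
    intro b rest m' b' h
    obtain ⟨m'', rfl⟩ : ∃ m'', m' = b :: m'' := by
      rcases m' with _ | ⟨x, m'⟩ <;> simp_all
    have := ih c (rest ++ [plain b]) m'' b' (by simpa using h)
    refine Relation.ReflTransGen.head (b := (hold c, m.map plain ++ (rest ++ [plain b]))) ?_ ?_
    · simp [QueueMachine.step, machine]
    · simpa using! this

theorem reaches_copy (r : List Γ) : ∀ rest : List (Letter Γ Λ),
    Reaches (machine M).step (copy, r.map plain ++ sep :: rest)
      (hold default, rest ++ (r.map plain ++ [sep])) := by
  induction r with
  | nil =>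
    intro rest
    refine Relation.ReflTransGen.single ?_
    simp [QueueMachine.step, machine]
  | cons c r ih =>
    intro rest
    refine Relation.ReflTransGen.head (b := (copy, r.map plain ++ sep :: (rest ++ [plain c]))) ?_ ?_
    · simp [QueueMachine.step, machine]
    · have h := ih (rest ++ [plain c])
      rw [List.append_assoc] at h
      simpa using! h

theorem reaches_drain (w : List (Letter Γ Λ)) :
    Reaches (machine M).step (drain, w) (drain, []) := by
  induction w with
  | nil => exact .refl
  | cons a w ih =>
    refine Relation.ReflTransGen.head (b := (drain, w)) ?_ ih
    simp [QueueMachine.step, machine]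

/-- The tape with `a` under the head, `l` to its left (nearest cell first) and `r` to its right,
written from left to right. -/
def tapeWord (q : Λ) (l : List Γ) (a : Γ) (r : List Γ) : List (Letter Γ Λ) :=
  l.reverse.map plain ++ head q a :: (r.map plain ++ [sep])

/-- A queue configuration at the start of a rotation represents a Turing machine configuration. As
`l` and `r` may end in blanks, a Turing machine configuration has several representations. -/
inductive Represents : TM0.Cfg Γ Λ → Phase Γ Λ × List (Letter Γ Λ) → Prop
  | mk (q : Λ) (l : List Γ) (a : Γ) (r : List Γ) :
    Represents ⟨q, ⟨a, .mk l, .mk r⟩⟩ (hold default, tapeWord q l a r)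

theorem listBlank_mk_append_default (l : List Γ) :
    ListBlank.mk (l ++ [default]) = ListBlank.mk l :=
  (Quotient.sound (s := BlankRel.setoid Γ) (Or.inl ⟨1, rfl⟩)).symm

theorem Represents.step_none {c : TM0.Cfg Γ Λ} {w : Phase Γ Λ × List (Letter Γ Λ)}
    (h : Represents c w) (hc : TM0.step M c = none) :
    Reaches (machine M).step w (drain, []) := by
  obtain ⟨q, l, a, r⟩ := h
  replace hc : M q a = none := by simpa [TM0.step] using hc
  obtain ⟨m, b, hm⟩ : ∃ m b, (default : Γ) :: l.reverse = m ++ [b] :=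
    ⟨_, _, (List.dropLast_append_getLast (by simp)).symm⟩
  refine (reaches_hold M _ _ (head q a :: (r.map plain ++ [sep])) _ _ hm).trans ?_
  refine Relation.ReflTransGen.head ?_ (reaches_drain M ((r.map plain ++ [sep]) ++ m.map plain))
  simp [QueueMachine.step, machine, hc]

theorem Represents.step_some {c c' : TM0.Cfg Γ Λ} {w : Phase Γ Λ × List (Letter Γ Λ)}
    (h : Represents c w) (hc : TM0.step M c = some c') :
    ∃ w', Represents c' w' ∧ Reaches₁ (machine M).step w w' := by
  obtain ⟨q, l, a, r⟩ := h
  -- The blank held at the start of the rotation extends the left part, so that there is a cell `b`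
  -- to the left of the head, which is held when the head is met.
  obtain ⟨b, l', hl⟩ : ∃ b l', l ++ [default] = b :: l' := by
    cases l <;> simp
  have hblank : ListBlank.mk l = ListBlank.mk (b :: l') := by
    rw [← hl, listBlank_mk_append_default]
  have hm : (default : Γ) :: l.reverse = l'.reverse ++ [b] := by
    simpa using congrArg List.reverse hl
  have hhold := reaches_hold M _ _ (head q a :: (r.map plain ++ [sep])) _ _ hm
  obtain ⟨⟨q', s⟩, hM, rfl⟩ : ∃ p, M q a = some p ∧ _ = c' := by
    simpa only [TM0.step, Option.map_eq_some_iff] using hc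
  rw [hblank]
  have key : ∀ (u : List (Letter Γ Λ)) (p : Phase Γ Λ) (w'),
      machine M (hold b) (head q a) = (u, p) →
      Reaches (machine M).step (p, r.map plain ++ sep :: (l'.reverse.map plain ++ u)) w' →
      Reaches₁ (machine M).step (hold default, tapeWord q l a r) w' := by
    intro u p w' hp hw
    refine Relation.TransGen.trans_right hhold (Relation.TransGen.head' ?_ hw)
    simp [QueueMachine.step, hp]
  rcases s with (_ | _) | a'
  · refine ⟨(hold default, tapeWord q' l' b (a :: r)), ?_,
      key [head q' b, plain a] copy _ (by simp [machine, hM]) ?_⟩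
    · simpa [Tape.move] using Represents.mk q' l' b (a :: r)
    · have h := reaches_copy M r (l'.reverse.map plain ++ [head q' b, plain a])
      rw [List.append_assoc] at h
      simpa [tapeWord] using! h
  · rcases r with _ | ⟨c, r⟩
    · refine ⟨(hold default, tapeWord q' (a :: b :: l') default []), ?_,
        key [plain b, plain a] (mark q') _ (by simp [machine, hM]) (.single ?_)⟩
      · simpa [Tape.move] using Represents.mk q' (a :: b :: l') default []
      · simp [tapeWord, machine, QueueMachine.step]
    · refine ⟨(hold default, tapeWord q' (a :: b :: l') c r), ?_,
        key [plain b, plain a] (mark q') _ (by simp [machine, hM])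
          (.head (b := (copy, r.map plain ++
            sep :: (l'.reverse.map plain ++ [plain b, plain a, head q' c]))) ?_ ?_)⟩
      · simpa [Tape.move] using Represents.mk q' (a :: b :: l') c r
      · simp [machine, QueueMachine.step]
      · have h := reaches_copy M r
          (l'.reverse.map plain ++ [plain b, plain a, head q' c])
        rw [List.append_assoc] at h
        simpa [tapeWord] using! h
  · refine ⟨(hold default, tapeWord q' (b :: l') a' r), ?_,
      key [plain b, head q' a'] copy _ (by simp [machine, hM]) ?_⟩
    · simpa [Tape.write] using Represents.mk q' (b :: l') a' r
    · have h := reaches_copy M r (l'.reverse.map plain ++ [plain b, head q' a'])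
      rw [List.append_assoc] at h
      simpa [tapeWord] using! h

theorem empties_iff_dom {c : TM0.Cfg Γ Λ} {w : Phase Γ Λ × List (Letter Γ Λ)}
    (h : Represents c w) :
    (machine M).Empties w ↔ (eval (TM0.step M) c).Dom := by
  -- A Turing machine that has halted corresponds to the empty queue, not to a tape word: this is
  -- what `Respects` asks for, since the queue machine stops only there.
  let R : TM0.Cfg Γ Λ → Phase Γ Λ × List (Letter Γ Λ) → Prop := fun c w =>
    (TM0.step M c = none ∧ w = (drain, [])) ∨ (TM0.step M c ≠ none ∧ Represents c w)
  have hR : Respects (TM0.step M) (machine M).step R := by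
    intro c w hcw
    rcases hcw with ⟨hc, rfl⟩ | ⟨hc, hw⟩
    · rw [hc]; rfl
    · obtain ⟨c', hc'⟩ := Option.ne_none_iff_exists'.1 hc
      rw [hc']
      obtain ⟨w', hw', hreach⟩ := hw.step_some M hc'
      by_cases hn : TM0.step M c' = none
      · exact ⟨_, .inl ⟨hn, rfl⟩, hreach.trans_left (hw'.step_none M hn)⟩
      · exact ⟨w', .inr ⟨hn, hw'⟩, hreach⟩
  by_cases hn : TM0.step M c = none
  · exact iff_of_true ⟨drain, h.step_none M hn⟩
      (Part.dom_iff_mem.2 ⟨c, mem_eval.2 ⟨.refl, hn⟩⟩)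
  · rw [QueueMachine.empties_iff_dom]
    exact tr_eval_dom hR (.inr ⟨hn, h⟩)

end TapeRotation

/-- The domain of a partial recursive function is the set of inputs on which a single finite queue
machine, started on the binary digits of the input between two fixed letters, empties its queue. -/
theorem exists_queueMachine {f : ℕ →. ℕ} (hf : Partrec f) :
    ∃ (Q A : Type) (_ : Finite Q) (_ : Finite A) (δ : QueueMachine Q A) (q : Q) (a e : A)
      (g : PartrecToTM2.Γ' → A), ∀ n : ℕ,
      δ.Empties (q, a :: ((PartrecToTM2.trNat n).reverse.map g ++ [e])) ↔ (f n).Dom := by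
  obtain ⟨Γ, Λ, _, _, _, _, M, a, g, h⟩ := exists_finite_turingMachine hf
  refine ⟨TapeRotation.Phase Γ Λ, TapeRotation.Letter Γ Λ, inferInstance, inferInstance,
    TapeRotation.machine M, .hold default, .head default a, .sep, fun x => .plain (g x),
    fun n => ?_⟩
  rw [← h n]
  have := TapeRotation.empties_iff_dom M
    (TapeRotation.Represents.mk (default : Λ) [] a ((PartrecToTM2.trNat n).reverse.map g))
  simpa [TapeRotation.tapeWord, TM0.init, Tape.mk₁, Tape.mk₂, Tape.mk', Function.comp_def]
    using! this

end TuringMachines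

/-! ### Straight-line programs of affine maps -/

/-- An affine map `x ↦ A x + b` on integer vectors. -/
abbrev AffineOp (d : ℕ) : Type := Matrix (Fin d) (Fin d) ℤ × (Fin d → ℤ)

/-- The effect of performing a list of affine maps, the first one first. -/
def AffineOp.run {d : ℕ} (l : List (AffineOp d)) (u : Fin d → ℤ) : Fin d → ℤ :=
  l.foldl (fun u o => o.1.mulVec u + o.2) u

theorem AffineOp.run_append {d : ℕ} (l l' : List (AffineOp d)) (u : Fin d → ℤ) :
    AffineOp.run (l ++ l') u = AffineOp.run l' (AffineOp.run l u) :=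
  List.foldl_append

/-- A program whose rules `r : R` lead from the state `src r` to the state `dst r` and perform the
affine maps `ops r` in order. -/
structure AffineProgram (d : ℕ) (Q R : Type) where
  src : R → Q
  ops : R → List (AffineOp d)
  dst : R → Q

namespace AffineProgram

variable {d : ℕ} {Q R : Type}

/-- One rule is applied. -/
def Step (P : AffineProgram d Q R) (c c' : Q × (Fin d → ℤ)) : Prop :=
  ∃ r, c = (P.src r, c.2) ∧ c' = (P.dst r, AffineOp.run (P.ops r) c.2)

/-- Reachability by applications of rules. -/
def Reaches (P : AffineProgram d Q R) : Q × (Fin d → ℤ) → Q × (Fin d → ℤ) → Prop :=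
  Relation.ReflTransGen P.Step

/-- The control states of the VASS of a program: the states of the program and, for every rule, the
positions between its affine maps. -/
abbrev Node (P : AffineProgram d Q R) : Type := Q ⊕ Σ r : R, Fin ((P.ops r).length + 1)

/-- The transitions of the VASS of a program: for every rule those that enter it, perform one of
its affine maps, and leave it. -/
abbrev Edge (P : AffineProgram d Q R) : Type := R ⊕ (Σ r : R, Fin (P.ops r).length) ⊕ R

/-- The transition that belongs to an edge. -/
def transition (P : AffineProgram d Q R) : P.Edge → VASSTransition d P.Node
  | .inl r => (.inl (P.src r), 1, 0, .inr ⟨r, 0⟩)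
  | .inr (.inl ⟨r, i⟩) =>
    (.inr ⟨r, i.castSucc⟩, ((P.ops r).get i).1, ((P.ops r).get i).2, .inr ⟨r, i.succ⟩)
  | .inr (.inr r) => (.inr ⟨r, Fin.last _⟩, 1, 0, .inl (P.dst r))

open scoped Classical in
/-- The affine VASS in which every rule of the program is a path through positions of its own; `e`
numbers the control states. -/
noncomputable def toVASS [Fintype R] (P : AffineProgram d Q R) {n : ℕ} (e : P.Node ≃ Fin n) :
    AffineZVASS d (Fin n) where
  transitions := Finset.univ.image fun t : P.Edge =>
    (e (P.transition t).1, (P.transition t).2.1, (P.transition t).2.2.1, e (P.transition t).2.2.2)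

variable [Fintype R] (P : AffineProgram d Q R) {n : ℕ} (e : P.Node ≃ Fin n)

theorem toVASS_step_iff {s s' : P.Node} {u u' : Fin d → ℤ} :
    (P.toVASS e).Step (e s, u) (e s', u') ↔
      ∃ t, (P.transition t).1 = s ∧ (P.transition t).2.2.2 = s' ∧
        u' = (P.transition t).2.1.mulVec u + (P.transition t).2.2.1 := by
  constructor
  · rintro ⟨A, b, h, hu⟩
    obtain ⟨t, -, ht⟩ := Finset.mem_image.1 h
    simp only [Prod.mk.injEq, EmbeddingLike.apply_eq_iff_eq] at ht
    obtain ⟨h₁, rfl, rfl, h₂⟩ := ht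
    exact ⟨t, h₁, h₂, hu⟩
  · rintro ⟨t, rfl, rfl, hu⟩
    exact ⟨_, _, Finset.mem_image.2 ⟨t, Finset.mem_univ _, rfl⟩, hu⟩

theorem toVASS_reaches_of_reaches {c c' : Q × (Fin d → ℤ)} (h : P.Reaches c c') :
    (P.toVASS e).Reaches (e (.inl c.1), c.2) (e (.inl c'.1), c'.2) := by
  refine Relation.ReflTransGen.lift' (fun c : Q × (Fin d → ℤ) => (e (.inl c.1), c.2)) ?_ _ _ h
  rintro ⟨q, u⟩ _ ⟨r, hc, rfl⟩
  obtain rfl : q = P.src r := congrArg Prod.fst hc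
  -- The positions inside the path of the rule `r` are reached one after the other.
  have mid : ∀ i (hi : i < (P.ops r).length + 1),
      (P.toVASS e).Reaches (e (.inl (P.src r)), u)
        (e (.inr ⟨r, i, hi⟩), AffineOp.run ((P.ops r).take i) u) := by
    intro i
    induction i with
    | zero =>
      intro hi
      refine .single ((P.toVASS_step_iff e).2 ⟨.inl r, rfl, rfl, ?_⟩)
      simp [transition, AffineOp.run]
    | succ i ih =>
      intro hi
      refine (ih (by omega)).tail
        ((P.toVASS_step_iff e).2 ⟨.inr (.inl ⟨r, i, by omega⟩), rfl, rfl, ?_⟩)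
      rw [List.take_succ_eq_append_getElem (by omega), AffineOp.run_append]
      rfl
  refine (mid (P.ops r).length (Nat.lt_succ_self _)).tail
    ((P.toVASS_step_iff e).2 ⟨.inr (.inr r), rfl, rfl, ?_⟩)
  simp [transition]

/-- The invariant of the runs of the VASS from a program configuration `c`: a state of the program
is reached with a vector only if the program reaches it, and a position inside a rule only with the
result of the preceding maps of that rule on such a vector. -/
def Simulates (c : Q × (Fin d → ℤ)) : P.Node × (Fin d → ℤ) → Prop
  | (.inl q, u) => P.Reaches c (q, u)
  | (.inr ⟨r, i⟩, u) => ∃ w, P.Reaches c (P.src r, w) ∧ u = AffineOp.run ((P.ops r).take i) w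

theorem reaches_of_toVASS_reaches {c c' : Q × (Fin d → ℤ)}
    (h : (P.toVASS e).Reaches (e (.inl c.1), c.2) (e (.inl c'.1), c'.2)) : P.Reaches c c' := by
  suffices H : ∀ x, (P.toVASS e).Reaches (e (.inl c.1), c.2) x →
      P.Simulates c (e.symm x.1, x.2) by
    simpa [Simulates] using H _ h
  intro x hx
  induction hx with
  | refl => simpa [Simulates] using! Relation.ReflTransGen.refl
  | @tail y z _ hstep ih =>
    obtain ⟨s, u⟩ := y
    obtain ⟨s', u'⟩ := z
    obtain ⟨s, rfl⟩ := e.surjective s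
    obtain ⟨s', rfl⟩ := e.surjective s'
    obtain ⟨t, rfl, rfl, rfl⟩ := (P.toVASS_step_iff e).1 hstep
    simp only [Equiv.symm_apply_apply] at ih ⊢
    rcases t with r | ⟨r, i⟩ | r
    · exact ⟨u, ih, by simp [transition, AffineOp.run]⟩
    · obtain ⟨w, hw, rfl⟩ := ih
      refine ⟨w, hw, ?_⟩
      rw [Fin.val_succ, List.take_succ_eq_append_getElem i.2, AffineOp.run_append]
      rfl
    · obtain ⟨w, hw, rfl⟩ := ih
      refine hw.tail ⟨r, rfl, ?_⟩
      simp [transition]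

theorem toVASS_reaches_iff {c c' : Q × (Fin d → ℤ)} :
    (P.toVASS e).Reaches (e (.inl c.1), c.2) (e (.inl c'.1), c'.2) ↔ P.Reaches c c' :=
  ⟨P.reaches_of_toVASS_reaches e, P.toVASS_reaches_of_reaches e⟩

theorem eq_one_or_of_mem_toVASS_matrices {A : Matrix (Fin d) (Fin d) ℤ}
    (hA : A ∈ (P.toVASS e).matrices) : A = 1 ∨ ∃ r, ∃ o ∈ P.ops r, A = o.1 := by
  obtain ⟨_, ht, rfl⟩ := hA
  obtain ⟨t, -, rfl⟩ := Finset.mem_image.1 ht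
  rcases t with r | ⟨r, i⟩ | r
  · exact .inl rfl
  · exact .inr ⟨r, _, List.get_mem _ i, rfl⟩
  · exact .inl rfl

end AffineProgram

/-! ### Words as numbers -/

/-- The number written by the word `w` in base `2 ^ k`, with digits `dig`. -/
def wordValue {A : Type} (k : ℕ) (dig : A → ℕ) (w : List A) : ℕ :=
  w.foldl (fun x a => 2 ^ k * x + dig a) 0

section WordValue

variable {A : Type} {k : ℕ} {dig : A → ℕ}

theorem wordValue_concat (w : List A) (a : A) :
    wordValue k dig (w ++ [a]) = 2 ^ k * wordValue k dig w + dig a := by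
  simp [wordValue]

/-- A word is determined by its value, its length included, as the digit `0` is not used. -/
theorem wordValue_injective (hpos : ∀ a, 0 < dig a) (hlt : ∀ a, dig a < 2 ^ k)
    (hinj : Function.Injective dig) : Function.Injective (wordValue k dig) := by
  intro w
  induction w using List.reverseRecOn with
  | nil =>
    intro w' h
    rcases List.eq_nil_or_concat w' with rfl | ⟨v, a, rfl⟩
    · rfl
    · rw [List.concat_eq_append, wordValue_concat] at h
      have := hpos a
      simp only [wordValue, List.foldl_nil] at h
      omega
  | append_singleton w a ih =>
    intro w' h
    rcases List.eq_nil_or_concat w' with rfl | ⟨v, b, rfl⟩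
    · rw [wordValue_concat] at h
      have := hpos a
      simp only [wordValue, List.foldl_nil] at h
      omega
    · rw [List.concat_eq_append, wordValue_concat, wordValue_concat] at h
      have hmod := congrArg (· % 2 ^ k) h
      have hdiv := congrArg (· / 2 ^ k) h
      have hk : 0 < 2 ^ k := by positivity
      simp only [Nat.mul_add_mod, Nat.mod_eq_of_lt (hlt _)] at hmod
      simp only [Nat.mul_add_div hk, Nat.div_eq_of_lt (hlt _), add_zero] at hdiv
      rw [List.concat_eq_append, ih hdiv, hinj hmod]

end WordValue

section ThreeCounters

open Matrix

/-! ### Appending a digit by copies and transfers -/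

/-- The counter `i ∈ {0, 1}` is copied into the scratch counter `2`. -/
def copyOp (i : Fin 2) : AffineOp 3 :=
  (![!![1, 0, 0; 0, 1, 0; 1, 0, 0], !![1, 0, 0; 0, 1, 0; 0, 1, 0]] i, 0)

/-- The scratch counter `2` is transferred to the counter `i ∈ {0, 1}`: it is added to it and reset
to `0`. After `copyOp i` this doubles the counter `i`. -/
def transferOp (i : Fin 2) : AffineOp 3 :=
  (![!![1, 0, 1; 0, 1, 0; 0, 0, 0], !![1, 0, 0; 0, 1, 1; 0, 0, 0]] i, 0)

/-- A constant vector is added. -/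
def addOp (v : Fin 3 → ℤ) : AffineOp 3 := (1, v)

/-- The counter `i ∈ {0, 1}` is multiplied by `2 ^ k` and increased by `n`, by means of `k`
doublings: the digit `n` is appended to its expansion in base `2 ^ k`. -/
def appendOps (i : Fin 2) (k n : ℕ) : List (AffineOp 3) :=
  (List.replicate k [copyOp i, transferOp i]).flatten ++
    [addOp (![![(n : ℤ), 0, 0], ![0, (n : ℤ), 0]] i)]

theorem isCopyMatrix_copyOp (i : Fin 2) : IsCopyMatrix (copyOp i).1 := by
  refine (isCopyMatrix_iff_exists _).2 ⟨![0, 1, i.castSucc], fun a b => ?_⟩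
  fin_cases i <;> fin_cases a <;> fin_cases b <;> rfl

theorem isTransferMatrix_transferOp (i : Fin 2) : IsTransferMatrix (transferOp i).1 := by
  rw [isTransferMatrix_iff_transpose]
  refine (isCopyMatrix_iff_exists _).2 ⟨![0, 1, i.castSucc], fun a b => ?_⟩
  fin_cases i <;> fin_cases a <;> fin_cases b <;> rfl

theorem isTransferMatrix_or_isCopyMatrix_of_mem_appendOps {i : Fin 2} {k n : ℕ} {o : AffineOp 3}
    (h : o ∈ appendOps i k n) : IsTransferMatrix o.1 ∨ IsCopyMatrix o.1 := by
  simp only [appendOps, List.mem_append, List.mem_flatten, List.mem_replicate,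
    List.mem_singleton] at h
  rcases h with ⟨l, ⟨-, rfl⟩, h⟩ | rfl
  · simp only [List.mem_cons, List.not_mem_nil, or_false] at h
    rcases h with rfl | rfl
    · exact .inr (isCopyMatrix_copyOp i)
    · exact .inl (isTransferMatrix_transferOp i)
  · exact .inr IsCopyMatrix.one

theorem run_appendOps_zero (k n : ℕ) (x y : ℤ) :
    AffineOp.run (appendOps 0 k n) ![x, y, 0] = ![2 ^ k * x + n, y, 0] := by
  have h : ∀ x, AffineOp.run (List.replicate k [copyOp 0, transferOp 0]).flatten ![x, y, 0] =
      ![2 ^ k * x, y, 0] := by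
    induction k with
    | zero => intro x; simp [AffineOp.run]
    | succ k ih =>
      intro x
      rw [List.replicate_succ, List.flatten_cons, AffineOp.run_append]
      have : AffineOp.run [copyOp 0, transferOp 0] ![x, y, 0] = ![2 * x, y, 0] := by
        ext j
        fin_cases j <;>
          simp [AffineOp.run, copyOp, transferOp, dotProduct, Fin.sum_univ_three, two_mul]
      rw [this, ih, pow_succ, mul_assoc]
  rw [appendOps, AffineOp.run_append, h]
  ext j
  fin_cases j <;> simp [AffineOp.run, addOp]

theorem run_appendOps_one (k n : ℕ) (x y : ℤ) :
    AffineOp.run (appendOps 1 k n) ![x, y, 0] = ![x, 2 ^ k * y + n, 0] := by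
  have h : ∀ y, AffineOp.run (List.replicate k [copyOp 1, transferOp 1]).flatten ![x, y, 0] =
      ![x, 2 ^ k * y, 0] := by
    induction k with
    | zero => intro y; simp [AffineOp.run]
    | succ k ih =>
      intro y
      rw [List.replicate_succ, List.flatten_cons, AffineOp.run_append]
      have : AffineOp.run [copyOp 1, transferOp 1] ![x, y, 0] = ![x, 2 * y, 0] := by
        ext j
        fin_cases j <;>
          simp [AffineOp.run, copyOp, transferOp, dotProduct, Fin.sum_univ_three, two_mul]
      rw [this, ih, pow_succ, mul_assoc]
  rw [appendOps, AffineOp.run_append, h]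
  ext j
  fin_cases j <;> simp [AffineOp.run, addOp]

/-! ### The program of a queue machine -/

namespace QueueMachine

variable {Q A : Type} (δ : QueueMachine Q A) (k : ℕ) (dig : A → ℕ)

/-- The program of a queue machine. Counter `0` holds the value of the word of all letters appended
to the queue so far, counter `1` that of all letters removed from it. The removed letter is
guessed. In any state of the machine the program may move to the final state `none`, where the two
counters are decreased together: they reach `0` only if they were equal. -/
def program : AffineProgram 3 (Option Q) ((Q × A) ⊕ Option Q) where
  src
    | .inl (q, _) => some q
    | .inr q => q
  ops
    | .inl (q, a) => appendOps 1 k (dig a) ++ (δ q a).1.flatMap fun b => appendOps 0 k (dig b)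
    | .inr none => [addOp ![-1, -1, 0]]
    | .inr (some _) => []
  dst
    | .inl (q, a) => some (δ q a).2
    | .inr _ => none

/-- The counters when the letters of `X` have been appended and those of `Y` removed. -/
def traceVector (X Y : List A) : Fin 3 → ℤ :=
  ![(wordValue k dig X : ℤ), (wordValue k dig Y : ℤ), 0]

theorem isTransferMatrix_or_isCopyMatrix_of_mem_ops {r} {o : AffineOp 3}
    (h : o ∈ (δ.program k dig).ops r) : IsTransferMatrix o.1 ∨ IsCopyMatrix o.1 := by
  rcases r with ⟨q, a⟩ | _ | q
  · rcases List.mem_append.1 h with h | h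
    · exact isTransferMatrix_or_isCopyMatrix_of_mem_appendOps h
    · obtain ⟨b, -, h⟩ := List.mem_flatMap.1 h
      exact isTransferMatrix_or_isCopyMatrix_of_mem_appendOps h
  · obtain rfl := List.mem_singleton.1 h
    exact .inr IsCopyMatrix.one
  · cases h

theorem run_flatMap_appendOps (u X Y : List A) :
    AffineOp.run (u.flatMap fun b => appendOps 0 k (dig b)) (traceVector k dig X Y) =
      traceVector k dig (X ++ u) Y := by
  induction u generalizing X with
  | nil => simp [AffineOp.run]
  | cons b u ih =>
    rw [List.flatMap_cons, AffineOp.run_append, traceVector, run_appendOps_zero]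
    have := ih (X ++ [b])
    rw [traceVector, wordValue_concat] at this
    simpa using this

theorem run_program_inl (q : Q) (a : A) (X Y : List A) :
    AffineOp.run ((δ.program k dig).ops (.inl (q, a))) (traceVector k dig X Y) =
      traceVector k dig (X ++ (δ q a).1) (Y ++ [a]) := by
  change AffineOp.run (appendOps 1 k (dig a) ++ _) _ = _
  rw [AffineOp.run_append, ← run_flatMap_appendOps]
  congr 1
  rw [traceVector, run_appendOps_one, traceVector, wordValue_concat]
  simp

theorem program_reaches_of_reaches {q q' : Q} {w w' : List A}
    (h : StateTransition.Reaches δ.step (q, w) (q', w')) (Y : List A) :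
    ∃ Y', (δ.program k dig).Reaches (some q, traceVector k dig (Y ++ w) Y)
      (some q', traceVector k dig (Y' ++ w') Y') := by
  generalize hc : (q, w) = c at h
  induction h using Relation.ReflTransGen.head_induction_on generalizing q w Y with
  | refl => 
    cases hc
    exact ⟨Y, .refl⟩
  | head hstep _ ih =>
    subst hc
    rcases w with _ | ⟨a, w⟩
    · cases hstep
    · obtain ⟨Y', hY'⟩ := ih (Y ++ [a]) (by simpa [step] using hstep)
      refine ⟨Y', .head ⟨.inl (q, a), rfl, ?_⟩ hY'⟩
      rw [run_program_inl]
      simp [program]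

theorem program_reaches_zero (n : ℕ) :
    (δ.program k dig).Reaches (none, ![(n : ℤ), (n : ℤ), 0]) (none, 0) := by
  induction n with
  | zero =>
    have h : ![((0 : ℕ) : ℤ), ((0 : ℕ) : ℤ), 0] = 0 := by simp
    rw [h]
    exact .refl
  | succ n ih =>
    refine .head ⟨.inr none, rfl, ?_⟩ ih
    simp [program, AffineOp.run, addOp]

theorem program_reaches_of_empties {q : Q} {w : List A} (h : δ.Empties (q, w)) :
    (δ.program k dig).Reaches (some q, traceVector k dig w []) (none, 0) := by
  obtain ⟨q', h⟩ := h
  obtain ⟨Y, hY⟩ := δ.program_reaches_of_reaches k dig h []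
  refine hY.trans (.head ⟨.inr (some q'), rfl, ?_⟩
    (δ.program_reaches_zero k dig (wordValue k dig Y)))
  simp [program, AffineOp.run, traceVector]

/-- A necessary condition for reaching the target `(none, 0)`. In the final state the two counters
agree. In a state of the machine, the appended word `X` and the removed word `Y` extend to a common
word, and if `X = Y ++ w`, the machine empties the queue `w`. The first part propagates backwards
along a run, and forces every guess of a removed letter to be the front letter of the queue. -/
def Completable : Option Q × (Fin 3 → ℤ) → Prop
  | (none, u) => u 0 = u 1
  | (some q, u) => ∀ X Y, u = traceVector k dig X Y →
      (∃ U V, X ++ U = Y ++ V) ∧ ∀ w, X = Y ++ w → δ.Empties (q, w)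

theorem completable_of_program_reaches (hval : Function.Injective (wordValue k dig))
    {c : Option Q × (Fin 3 → ℤ)} (h : (δ.program k dig).Reaches c (none, 0)) :
    δ.Completable k dig c := by
  induction h using Relation.ReflTransGen.head_induction_on with
  | refl => simp [Completable]
  | @head c c' hstep _ ih =>
    obtain ⟨r, hc, rfl⟩ := hstep
    rw [hc]
    generalize c.2 = u at ih ⊢
    rcases r with ⟨q, a⟩ | _ | q
    · rintro X Y rfl
      obtain ⟨⟨U, V, hUV⟩, hw⟩ := ih _ _ (run_program_inl δ k dig q a X Y)
      refine ⟨⟨(δ q a).1 ++ U, [a] ++ V, by simpa using hUV⟩, ?_⟩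
      rintro (_ | ⟨b, w⟩) rfl
      · exact ⟨q, .refl⟩
      · obtain rfl : b = a := by
          simp only [List.append_assoc, List.append_cancel_left_eq, List.cons_append,
            List.nil_append, List.cons.injEq] at hUV
          exact hUV.1
        rw [empties_cons]
        exact hw _ (by simp)
    · have h : ((1 : Matrix (Fin 3) (Fin 3) ℤ) *ᵥ u) 0 + -1 =
          ((1 : Matrix (Fin 3) (Fin 3) ℤ) *ᵥ u) 1 + -1 := ih
      rw [one_mulVec] at h
      exact add_right_cancel (b := (-1 : ℤ)) h
    · rintro X Y rfl
      have hXY : X = Y := hval (by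
        simpa [Completable, program, AffineOp.run, traceVector] using ih)
      subst hXY
      exact ⟨⟨[], [], rfl⟩, fun w hw => by
        obtain rfl : w = [] := by simpa using hw
        exact ⟨q, .refl⟩⟩

theorem program_reaches_iff (hval : Function.Injective (wordValue k dig)) (q : Q) (w : List A) :
    (δ.program k dig).Reaches (some q, traceVector k dig w []) (none, 0) ↔ δ.Empties (q, w) :=
  ⟨fun h => (δ.completable_of_program_reaches k dig hval h w [] rfl).2 w rfl,
    δ.program_reaches_of_empties k dig⟩

end QueueMachine

end ThreeCounters

/-! ### Computability of the reduction -/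

section Computability

open Turing

/-- The recursion of the binary digits, least significant first. -/
theorem trNat_eq_cons {n : ℕ} (hn : n ≠ 0) :
    PartrecToTM2.trNat n =
      (if n % 2 = 1 then PartrecToTM2.Γ'.bit1 else .bit0) :: PartrecToTM2.trNat (n / 2) := by
  unfold PartrecToTM2.trNat
  rcases Nat.even_or_odd' n with ⟨m, rfl | rfl⟩
  · have h : ((2 * m : ℕ) : Num) = (m : Num).bit0 := by
      rw [← Num.bit0_of_bit0, two_mul, Nat.cast_add]
    have hm : (m : Num) ≠ 0 := by
      intro h0
      have := congrArg (fun x : Num => (x : ℕ)) h0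
      simp at this
      omega
    rw [h, Nat.mul_mod_right, Nat.mul_div_cancel_left m two_pos]
    rcases hp : (m : Num) with _ | p
    · exact absurd hp hm
    · rfl
  · have h : ((2 * m + 1 : ℕ) : Num) = (m : Num).bit1 := by
      rw [← Num.bit1_of_bit1, two_mul, Nat.cast_add, Nat.cast_add, Nat.cast_one]
    rw [h, show (2 * m + 1) % 2 = 1 by omega, show (2 * m + 1) / 2 = m by omega]
    rcases hp : (m : Num) with _ | p <;> rfl

theorem primrec_natCast_int : Primrec fun n : ℕ => (n : ℤ) := by
  rw [← Primrec.encode_iff]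
  -- Nonnegative integers are encoded as the even numbers.
  exact (Primrec.nat_mul.comp (.const 2) .id : Primrec fun n : ℕ => 2 * n)

theorem primrec_of_halving {f : ℕ → ℕ} {m c₀ c₁ : ℕ}
    (hf : ∀ n, n ≠ 0 → f n = m * f (n / 2) + if n % 2 = 1 then c₁ else c₀) : Primrec f := by
  let g : Unit → List ℕ → Option ℕ := fun _ l =>
    if l.length = 0 then some (f 0) else
      (l[l.length / 2]?).map fun x => m * x + if l.length % 2 = 1 then c₁ else c₀
  have hg : Primrec₂ g := by
    have hlen : Primrec fun p : Unit × List ℕ => p.2.length :=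
      Primrec.list_length.comp .snd
    refine Primrec.ite (Primrec.eq.comp hlen (.const 0)) (.const _) ?_
    refine Primrec.option_map
      (Primrec.list_getElem?.comp .snd (Primrec.nat_div.comp hlen (.const 2))) ?_
    refine Primrec.nat_add.comp (Primrec.nat_mul.comp (.const m) .snd)
      (Primrec.ite (Primrec.eq.comp (Primrec.nat_mod.comp (hlen.comp .fst) (.const 2)) (.const 1))
        (.const _) (.const _))
  have h : Primrec₂ fun (_ : Unit) => f := by
    refine Primrec.nat_strong_rec _ hg fun _ n => ?_
    rcases Nat.eq_zero_or_pos n with rfl | hn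
    · simp [g]
    · have : n / 2 < n := by omega
      simp [g, this, hn.ne', hf n hn.ne']
  exact h.comp (.const ()) .id

theorem primrec_wordValue_trNat {A : Type} (k : ℕ) (dig : A → ℕ) (a e : A)
    (g : PartrecToTM2.Γ' → A) :
    Primrec fun n => wordValue k dig (a :: ((PartrecToTM2.trNat n).reverse.map g ++ [e])) := by
  have h : Primrec fun n => wordValue k dig (a :: (PartrecToTM2.trNat n).reverse.map g) := by
    refine primrec_of_halving (m := 2 ^ k) (c₁ := dig (g .bit1)) (c₀ := dig (g .bit0))
      fun n hn => ?_
    rw [trNat_eq_cons hn, List.reverse_cons, List.map_append, ← List.cons_append,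
      List.map_singleton, wordValue_concat]
    split_ifs <;> rfl
  refine (Primrec.nat_add.comp (Primrec.nat_mul.comp (.const (2 ^ k)) h) (.const (dig e))).of_eq
    fun n => ?_
  rw [← List.cons_append, wordValue_concat]

end Computability

/-! ### Undecidability -/

theorem ReachDecidableOn.anti {P P' : ReachInput → Prop} (h : ∀ I, P I → P' I)
    (hP' : ReachDecidableOn P') : ReachDecidableOn P := by
  obtain ⟨f, hf, hcorrect⟩ := hP'
  exact ⟨f, hf, fun I x hI => hcorrect I x (h I hI)⟩

theorem AffineZVASS.belongsTo_transfer_add_copy {d : ℕ} {Q : Type} {V : AffineZVASS d Q}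
    (h : ∀ A ∈ V.matrices, IsTransferMatrix A ∨ IsCopyMatrix A) :
    V.BelongsTo (transferClass.add copyClass) :=
  Submonoid.closure_le.2 fun A hA => (h A hA).elim
    (fun h => (le_sup_left : transferClass d ≤ _) h)
    (fun h => (le_sup_right : copyClass d ≤ transferClass d ⊔ copyClass d) h)

open Nat.Partrec (Code) in
/-- The halting problem reduces to reachability in a single program over three counters, in which
only the first counter of the source depends on the instance. -/
theorem exists_affineProgram :
    ∃ (Q R : Type) (_ : Finite Q) (_ : Finite R) (P : AffineProgram 3 Q R) (q q' : Q) (v : ℕ → ℕ),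
      (∀ r, ∀ o ∈ P.ops r, IsTransferMatrix o.1 ∨ IsCopyMatrix o.1) ∧ Primrec v ∧
      ∀ c : Code, P.Reaches (q, ![(v (Encodable.encode c) : ℤ), 0, 0]) (q', 0) ↔
        (c.eval 0).Dom := by
  have hf : Partrec fun n : ℕ => (Denumerable.ofNat Code n).eval 0 :=
    Code.eval_part.comp (Computable.ofNat Code) (Computable.const 0)
  obtain ⟨Q, A, _, _, δ, q, a, e, g, h⟩ := exists_queueMachine hf
  obtain ⟨k, ⟨num⟩⟩ := Finite.exists_equiv_fin A
  -- The digits `1, …, k` are less than the base `2 ^ (k + 1)`.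
  let dig : A → ℕ := fun x => num x + 1
  have hval : Function.Injective (wordValue (k + 1) dig) :=
    wordValue_injective (fun x => Nat.succ_pos _)
      (fun x => lt_of_le_of_lt (num x).2
        (Nat.lt_two_pow_self.trans (Nat.pow_lt_pow_succ one_lt_two)))
      (fun x y hxy => num.injective (Fin.ext (Nat.succ_injective hxy)))
  refine ⟨Option Q, (Q × A) ⊕ Option Q, inferInstance, inferInstance, δ.program (k + 1) dig,
    some q, none, _,
    fun r o ho => δ.isTransferMatrix_or_isCopyMatrix_of_mem_ops (k + 1) dig ho,
    primrec_wordValue_trNat (k + 1) dig a e g, fun c => ?_⟩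
  have := δ.program_reaches_iff (k + 1) dig hval q
    (a :: ((Turing.PartrecToTM2.trNat (Encodable.encode c)).reverse.map g ++ [e]))
  rw [h, Denumerable.ofNat_encode] at this
  exact this

theorem not_reachDecidableOn_dim_three :
    ¬ ReachDecidableOn (fun I => I.dim = 3 ∧
        ∀ A ∈ I.vass.matrices, IsTransferMatrix A ∨ IsCopyMatrix A) := by
  rintro ⟨f, hf, hcorrect⟩
  obtain ⟨Q, R, _, _, P, q, q', v, hP, hv, hred⟩ := exists_affineProgram
  have := Fintype.ofFinite R
  obtain ⟨n, ⟨e⟩⟩ := Finite.exists_equiv_fin P.Node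
  let I : Nat.Partrec.Code → ReachInput := fun c =>
    ⟨3, n, P.toVASS e, (e (.inl q), ![(v (Encodable.encode c) : ℤ), 0, 0]), (e (.inl q'), 0)⟩
  let ts := (P.toVASS e).transitions.toList
  let x : Nat.Partrec.Code → ReachCode := fun c =>
    (3, n, ts.map transitionCode, ((e (.inl q)).val, [(v (Encodable.encode c) : ℤ), 0, 0]),
      ((e (.inl q')).val, [0, 0, 0]))
  have hx : Computable x := by
    have hv' : Primrec fun c : Nat.Partrec.Code => (v (Encodable.encode c) : ℤ) :=
      primrec_natCast_int.comp (hv.comp .encode)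
    refine Primrec.to_comp (.pair (.const _) (.pair (.const _) (.pair (.const _)
      (.pair (.pair (.const _) ?_) (.const _)))))
    exact Primrec.list_cons.comp hv' (.const [0, 0])
  refine ComputablePred.halting_problem 0 (ComputablePred.computable_iff.2
    ⟨fun c => f (x c), hf.comp hx, funext fun c => propext ?_⟩)
  rw [hcorrect (I c) (x c) ⟨rfl, fun A hA => ?_⟩ ⟨ts, fun t => Finset.mem_toList, rfl⟩]
  · exact (hred c).symm.trans
      (P.toVASS_reaches_iff e (c := (q, _)) (c' := (q', 0))).symm
  · rcases P.eq_one_or_of_mem_toVASS_matrices e hA with rfl | ⟨r, o, ho, rfl⟩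
    · exact .inr IsCopyMatrix.one
    · exact hP r o ho

theorem mainTheorem6 :
    ¬ ReachDecidableOn (fun I => I.vass.BelongsTo (transferClass.add copyClass)) ∧
    ¬ ReachDecidableOn (fun I => I.dim = 3 ∧ I.vass.BelongsTo (transferClass.add copyClass)) ∧
    ¬ ReachDecidableOn (fun I => I.dim = 3 ∧
        ∀ A ∈ I.vass.matrices, IsTransferMatrix A ∨ IsCopyMatrix A) := by
  have h := not_reachDecidableOn_dim_three
  exact ⟨fun h' => h (h'.anti fun I hI => AffineZVASS.belongsTo_transfer_add_copy hI.2),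
    fun h' => h (h'.anti fun I hI => ⟨hI.1, AffineZVASS.belongsTo_transfer_add_copy hI.2⟩), h⟩
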